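/- Let $n\ge 1$. A uniform random recursive tree on $n$ vertices is grown from a single vertex (the root) by adding the remaining $n-1$ vertices one at a time, each being joined to a vertex chosen uniformly at random among those already present, independently of all previous choices. The descendants of a vertex $v$ are the vertices $u\ne v$ such that $v$ lies on the path from the root to $u$. Let $L_{k,n}$ be the number of vertices with exactly $k$ descendants and $M_{k,n}$ the number of vertices with at least $k$ descendants. (1) For all integers $k\ge 0$ and $n>k+1$, \[ \mathbb{E} L_{k,n}=\frac{n}{(k+1)(k+2)}, \] and for all real $t>0$, \[ \mathbb{P}\{L_{k,n}\ge \mathbb{E} L_{k,n}+t\}\le \exp\left(\frac{-8t^2(k+2)}{25\,\bigl(n+(k+1)(k+2)t/3\bigr)}\right), \] \[ \mathbb{P}\{L_{k,n}\le \mathbb{E} L_{k,n}-t\}\le \exp\left(\frac{-8t^2(k+2)}{25\,n}\right). \] (2) For all integers $k\ge 1$ and $n\ge 2$, \[ \mathbb{P}\left\{M_{k,n}\le \frac{n}{3k}\right\}\le k\exp\left(-\frac{n}{32k^2}\right). \] -/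

import Mathlib

open MeasureTheory

namespace RecursiveTree

/-- The choices made while a recursive tree on the `n` vertices `0, 1, …, n - 1` (in order of
arrival) grows from the single vertex `0`: for `i = 0, …, n - 2`, the vertex `i + 1` is joined to
the vertex `p i`, which is one of the `i + 1` vertices `0, …, i` already present. -/
abbrev History (n : ℕ) : Type := (i : Fin (n - 1)) → Fin ((i : ℕ) + 1)

/-- The law of a uniform random recursive tree on `n` vertices: the attachment choices are
independent, and each is uniform over the vertices already present. -/
noncomputable def uniformLaw (n : ℕ) : Measure (History n) :=
  Measure.pi fun i : Fin (n - 1) => (PMF.uniformOfFintype (Fin ((i : ℕ) + 1))).toMeasure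

/-- `v` is the parent of `u` in the tree, rooted at `0`, with attachment choices `p`. -/
def IsParent {n : ℕ} (p : History n) (v u : ℕ) : Prop :=
  ∃ i : Fin (n - 1), u = (i : ℕ) + 1 ∧ v = (p i : ℕ)

/-- `u` is a (proper) descendant of `v`: it is a child of `v`, or a child of a child, and so on. -/
def IsDescendant {n : ℕ} (p : History n) (v u : ℕ) : Prop :=
  Relation.TransGen (IsParent p) v u

open Classical in
/-- The number of descendants of the vertex `v`, not counting `v` itself. -/
noncomputable def numDescendants {n : ℕ} (p : History n) (v : ℕ) : ℕ :=
  ((Finset.range n).filter fun u => IsDescendant p v u).card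

/-- `L k n` is the number of vertices with exactly `k` descendants. -/
noncomputable def L (k n : ℕ) (p : History n) : ℕ :=
  ((Finset.range n).filter fun v => numDescendants p v = k).card

/-- `M k n` is the number of vertices with at least `k` descendants. -/
noncomputable def M (k n : ℕ) (p : History n) : ℕ :=
  ((Finset.range n).filter fun v => k ≤ numDescendants p v).card

/-- The expected number of vertices with exactly `k` descendants. -/
noncomputable def meanL (k n : ℕ) : ℝ :=
  ∫ p, (L k n p : ℝ) ∂(uniformLaw n)

end RecursiveTree

/-! Listing the vertices of a recursive tree in preorder, later children first, gives an arrangement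
of 0, …, m that starts with 0, where n = m + 1. This is a bijection (`treeOf_bijective`), so the
uniform law becomes that of a uniform permutation. The subtree of a vertex is the block of larger
labels just after it, so having at least k descendants means that the next k labels are larger
(`le_numDescendants_treeOf`). Thus M is a sum of indicators, each depending on a window of k + 1
positions, and L is a sum of differences, with windows of k + 2 positions.

Windows of length w whose starting points agree modulo w are disjoint, hence independent
(`expect_prod_eq`). Averaging the w classes by Jensen bounds the moment generating function
(`expect_exp_sum_le`), and Bernstein's argument gives the tails.

The constants this yields are too weak for L with k = 0 and for M with k = 1. There one has L 0 = n
- M 1, and M 1, the number of distinct parents, is controlled by a martingale and Hoeffding's lemma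
(`expect_exp_parents_step`). -/

namespace RecursiveTree

/-! ### Exponential moments and Bernstein tails for locally dependent indicators -/

section Concentration

open scoped BigOperators

variable {Ω : Type*} [Fintype Ω]

/-- For 0/1 values, exp(xX) is affine in X, so `hprod` with a = exp x - 1 is all the independence
needed; then 1 + y ≤ exp y. -/
lemma expect_exp_class_le (X : ℕ → Ω → ℝ) (q : ℕ → ℝ) (S : Finset ℕ) (x : ℝ)
    (h01 : ∀ j ω, X j ω = 0 ∨ X j ω = 1) (hq : ∀ j, 0 ≤ q j) (hq1 : ∀ j, q j ≤ 1)
    (hprod : ∀ a : ℝ, 𝔼 ω, ∏ j ∈ S, (1 + a * X j ω) = ∏ j ∈ S, (1 + a * q j)) :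
    𝔼 ω, Real.exp (x * ∑ j ∈ S, (X j ω - q j) - (∑ j ∈ S, q j) * (Real.exp x - 1 - x)) ≤ 1 := by
  have hx : ∀ ω, Real.exp (x * ∑ j ∈ S, (X j ω - q j) -
      (∑ j ∈ S, q j) * (Real.exp x - 1 - x)) =
      (∏ j ∈ S, (1 + (Real.exp x - 1) * X j ω)) *
        Real.exp (-((∑ j ∈ S, q j) * (Real.exp x - 1))) := by
    intro ω
    have h : ∀ j, 1 + (Real.exp x - 1) * X j ω = Real.exp (x * X j ω) := by
      intro j
      rcases h01 j ω with h | h <;> simp [h]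
    simp_rw [h]
    rw [← Real.exp_sum, ← Real.exp_add, Finset.sum_sub_distrib, ← Finset.mul_sum]
    congr 1
    ring
  simp_rw [hx]
  rw [← Finset.expect_mul, hprod, Real.exp_neg, ← div_eq_mul_inv, div_le_one (Real.exp_pos _),
    Finset.sum_mul, Real.exp_sum]
  refine Finset.prod_le_prod (fun j _ ↦ ?_) (fun j _ ↦ ?_)
  · nlinarith [hq1 j, mul_nonneg (hq j) (Real.exp_pos x).le]
  · rw [mul_comm, add_comm]
    exact Real.add_one_le_exp _

/-- A sum of indicators which splits into `w` classes, each with the moment generating function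
of a sum of independent indicators. -/
lemma expect_exp_sum_le (X : ℕ → Ω → ℝ) (q : ℕ → ℝ) (J : Finset ℕ) {w : ℕ} (hw : 0 < w) (u : ℝ)
    (h01 : ∀ j ω, X j ω = 0 ∨ X j ω = 1) (hq : ∀ j, 0 ≤ q j) (hq1 : ∀ j, q j ≤ 1)
    (hprod : ∀ r, ∀ a : ℝ, 𝔼 ω, ∏ j ∈ J with j % w = r, (1 + a * X j ω) =
      ∏ j ∈ J with j % w = r, (1 + a * q j)) :
    𝔼 ω, Real.exp (u * (∑ j ∈ J, X j ω - ∑ j ∈ J, q j)) ≤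
      Real.exp ((∑ j ∈ J, q j) / w * (Real.exp (w * u) - 1 - w * u)) := by
  have hw' : (0 : ℝ) < w := by exact_mod_cast hw
  set x : ℝ := w * u with hxdef
  have hmaps : ∀ j ∈ J, j % w ∈ Finset.range w := fun j _ ↦ Finset.mem_range.2 (Nat.mod_lt _ hw)
  -- Each class carries its own compensator, so its exponential has mean at most 1 whatever its
  -- size, and Jensen with equal weights 1/w suffices.
  let Z : ℕ → Ω → ℝ := fun r ω ↦ x * ∑ j ∈ J with j % w = r, (X j ω - q j) -
    (∑ j ∈ J with j % w = r, q j) * (Real.exp x - 1 - x)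
  have hsum : ∀ ω, u * (∑ j ∈ J, X j ω - ∑ j ∈ J, q j) -
      (∑ j ∈ J, q j) / w * (Real.exp x - 1 - x) = ∑ r ∈ Finset.range w, (1 / (w : ℝ)) • Z r ω := by
    intro ω
    have h1 := Finset.sum_fiberwise_of_maps_to hmaps (fun j ↦ X j ω - q j)
    have h2 := Finset.sum_fiberwise_of_maps_to hmaps q
    rw [← Finset.smul_sum, Finset.sum_sub_distrib, ← Finset.mul_sum, ← Finset.sum_mul, h1, h2,
      Finset.sum_sub_distrib, smul_eq_mul, hxdef]
    field_simp
  have hle : ∀ ω, Real.exp (u * (∑ j ∈ J, X j ω - ∑ j ∈ J, q j) -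
      (∑ j ∈ J, q j) / w * (Real.exp x - 1 - x)) ≤
        ∑ r ∈ Finset.range w, (1 / (w : ℝ)) * Real.exp (Z r ω) := by
    intro ω
    rw [hsum]
    refine convexOn_exp.map_sum_le (fun _ _ ↦ by positivity) ?_ (fun _ _ ↦ Set.mem_univ _)
    simp [hw'.ne']
  have hone : 𝔼 ω, Real.exp (u * (∑ j ∈ J, X j ω - ∑ j ∈ J, q j) -
      (∑ j ∈ J, q j) / w * (Real.exp x - 1 - x)) ≤ 1 := by
    refine (Finset.expect_le_expect fun ω _ ↦ hle ω).trans ?_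
    rw [Finset.expect_sum_comm]
    simp_rw [← Finset.mul_expect]
    refine (Finset.sum_le_sum fun r _ ↦ mul_le_mul_of_nonneg_left
      (expect_exp_class_le X q _ x h01 hq hq1 (hprod r)) (by positivity)).trans ?_
    simp [hw'.ne']
  simp_rw [Real.exp_sub (u * _)] at hone
  rwa [← Finset.expect_div, div_le_one (Real.exp_pos _)] at hone

lemma exp_neg_sub_le {x : ℝ} (hx : 0 ≤ x) : Real.exp (-x) - 1 + x ≤ x ^ 2 / 2 := by
  have h := Real.quadratic_le_exp_of_nonneg hx
  have h1 : Real.exp (-x) ≤ 1 - x + x ^ 2 / 2 := by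
    rw [Real.exp_neg, inv_le_iff_one_le_mul₀ (Real.exp_pos x)]
    -- (1 - x + x²/2)(1 + x + x²/2) = 1 + x⁴/4.
    nlinarith [mul_le_mul_of_nonneg_left h (by nlinarith [sq_nonneg (x - 1)] :
      0 ≤ 1 - x + x ^ 2 / 2), sq_nonneg (x ^ 2)]
  linarith

/-- Termwise comparison with a geometric series of ratio x/3, since (n + 2)! ≥ 2 · 3ⁿ. -/
lemma exp_sub_le {x : ℝ} (hx : 0 ≤ x) (hx3 : x < 3) :
    Real.exp x - 1 - x ≤ x ^ 2 / (2 * (1 - x / 3)) := by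
  have h1 : HasSum (fun n : ℕ ↦ x ^ n / n.factorial) (Real.exp x) := by
    rw [Real.exp_eq_exp_ℝ]
    exact NormedSpace.expSeries_div_hasSum_exp x
  have h2 := (hasSum_nat_add_iff' 2).2 h1
  have h3 := (hasSum_geometric_of_lt_one (by positivity : 0 ≤ x / 3) (by linarith)).mul_left
    (x ^ 2 / 2)
  have h4 := hasSum_le (fun n ↦ ?_) h2 h3
  · simp only [Finset.sum_range_succ, Finset.sum_range_zero] at h4
    have h5 : x ^ 2 / 2 * (1 - x / 3)⁻¹ = x ^ 2 / (2 * (1 - x / 3)) := by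
      rw [← div_div, ← div_eq_mul_inv]
    rw [h5] at h4
    norm_num at h4
    linarith
  · have h5 : (2 : ℝ) * 3 ^ n ≤ ((n + 2).factorial : ℝ) := by
      have := Nat.factorial_mul_pow_le_factorial (m := 2) (n := n)
      rw [add_comm 2 n] at this
      exact_mod_cast this
    calc x ^ (n + 2) / ((n + 2).factorial : ℝ) ≤ x ^ (n + 2) / (2 * 3 ^ n) := by gcongr
      _ = x ^ 2 / 2 * (x / 3) ^ n := by rw [pow_add, div_pow]; field_simp

open Classical in
/-- Markov's inequality for an exponential. -/
lemma expect_ite_le_exp_mul (f : Ω → ℝ) (P : Ω → Prop) (b : ℝ) (hP : ∀ ω, P ω → b ≤ f ω) :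
    𝔼 ω, (if P ω then (1 : ℝ) else 0) ≤ Real.exp (-b) * 𝔼 ω, Real.exp (f ω) := by
  rw [Finset.mul_expect]
  refine Finset.expect_le_expect fun ω _ ↦ ?_
  rw [← Real.exp_add]
  split_ifs with h
  · exact Real.one_le_exp (by linarith [hP ω h])
  · positivity

open Classical in
lemma expect_upper_tail_le (X : Ω → ℝ) {Q t w : ℝ} (hQ : 0 < Q) (ht : 0 < t) (hw : 0 < w)
    (hX : ∀ u, 𝔼 ω, Real.exp (u * (X ω - Q)) ≤ Real.exp (Q / w * (Real.exp (w * u) - 1 - w * u))) :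
    𝔼 ω, (if Q + t ≤ X ω then (1 : ℝ) else 0) ≤ Real.exp (-(t ^ 2 / (2 * w * (Q + t / 3)))) := by
  -- Bernstein's choice: the bound on the compensator becomes exactly half of the linear term x t /
  -- w.
  set x := t / (Q + t / 3) with hx
  have hx0 : 0 < x := by positivity
  have hx3 : x < 3 := by
    rw [hx, div_lt_iff₀ (by positivity)]
    linarith
  have hwx : w * (x / w) = x := by field_simp
  refine (expect_ite_le_exp_mul (fun ω ↦ x / w * (X ω - Q)) _ (x / w * t)
    fun ω h ↦ ?_).trans ?_
  · gcongr
    linarith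
  refine (mul_le_mul_of_nonneg_left (hX (x / w)) (Real.exp_pos _).le).trans ?_
  rw [← Real.exp_add, Real.exp_le_exp, hwx]
  have h := mul_le_mul_of_nonneg_left (exp_sub_le hx0.le hx3) (by positivity : 0 ≤ Q / w)
  have h1 : 1 - x / 3 = Q / (Q + t / 3) := by
    rw [hx]
    field_simp
    ring
  rw [h1] at h
  have h2 : Q / w * (x ^ 2 / (2 * (Q / (Q + t / 3)))) = t ^ 2 / (2 * w * (Q + t / 3)) := by
    rw [hx]
    field_simp
  have h3 : x / w * t = 2 * (t ^ 2 / (2 * w * (Q + t / 3))) := by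
    rw [hx]
    field_simp
  linarith

open Classical in
lemma expect_lower_tail_le (X : Ω → ℝ) {Q S t w : ℝ} (hQ : 0 ≤ Q) (hQS : Q ≤ S) (hS : 0 < S)
    (ht : 0 < t) (hw : 0 < w)
    (hX : ∀ u, 𝔼 ω, Real.exp (u * (X ω - Q)) ≤ Real.exp (Q / w * (Real.exp (w * u) - 1 - w * u))) :
    𝔼 ω, (if X ω ≤ Q - t then (1 : ℝ) else 0) ≤ Real.exp (-(t ^ 2 / (2 * w * S))) := by
  set x := t / S with hx
  have hx0 : 0 < x := by positivity
  have hwx : w * (-x / w) = -x := by field_simp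
  refine (expect_ite_le_exp_mul (fun ω ↦ -x / w * (X ω - Q)) _ (x / w * t)
    fun ω h ↦ ?_).trans ?_
  · have : x / w * t ≤ x / w * (Q - X ω) := by
      gcongr
      linarith
    calc x / w * t ≤ x / w * (Q - X ω) := this
      _ = -x / w * (X ω - Q) := by ring
  refine (mul_le_mul_of_nonneg_left (hX (-x / w)) (Real.exp_pos _).le).trans ?_
  rw [← Real.exp_add, Real.exp_le_exp, hwx, sub_neg_eq_add]
  have h := mul_le_mul_of_nonneg_left (exp_neg_sub_le hx0.le) (by positivity : 0 ≤ Q / w)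
  have h2 : Q / w * (x ^ 2 / 2) ≤ S / w * (x ^ 2 / 2) := by gcongr
  have h3 : S / w * (x ^ 2 / 2) = t ^ 2 / (2 * w * S) := by
    rw [hx]
    field_simp
  have h4 : x / w * t = 2 * (t ^ 2 / (2 * w * S)) := by
    rw [hx]
    field_simp
  linarith

end Concentration

/-! ### Arrangements of labels and independence of disjoint windows -/

section Labels

open scoped BigOperators

variable {m : ℕ}

/-- The label at position `x` of the arrangement of `0, 1, …, m` which starts with `0` and goes on
as prescribed by `σ`. Positions after the last one have the label `0`. -/
def lab (σ : Equiv.Perm (Fin m)) : ℕ → ℕ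
  | 0 => 0
  | x + 1 => if h : x < m then (σ ⟨x, h⟩ : ℕ) + 1 else 0

@[simp] lemma lab_zero (σ : Equiv.Perm (Fin m)) : lab σ 0 = 0 := rfl

lemma lab_succ (σ : Equiv.Perm (Fin m)) (i : Fin m) : lab σ ((i : ℕ) + 1) = σ i + 1 := by
  simp [lab]

lemma lab_of_lt (σ : Equiv.Perm (Fin m)) {x : ℕ} (h : m < x) : lab σ x = 0 := by
  obtain ⟨y, rfl⟩ : ∃ y, x = y + 1 := ⟨x - 1, by omega⟩
  simp [lab, show ¬ y < m by omega]

lemma exists_fin_of_mem {x : ℕ} (h0 : 0 < x) (hm : x ≤ m) : ∃ i : Fin m, x = (i : ℕ) + 1 :=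
  ⟨⟨x - 1, by omega⟩, by simp; omega⟩

lemma lab_pos_iff (σ : Equiv.Perm (Fin m)) {x : ℕ} : 0 < lab σ x ↔ 0 < x ∧ x ≤ m := by
  constructor
  · intro h
    refine ⟨Nat.pos_of_ne_zero ?_, ?_⟩
    · rintro rfl
      simp at h
    · by_contra hx
      rw [lab_of_lt σ (by omega)] at h
      omega
  · rintro ⟨h0, hm⟩
    obtain ⟨i, rfl⟩ := exists_fin_of_mem h0 hm
    rw [lab_succ]
    omega

lemma lab_le (σ : Equiv.Perm (Fin m)) (x : ℕ) : lab σ x ≤ m := by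
  rcases Nat.eq_zero_or_pos (lab σ x) with h | h
  · omega
  · obtain ⟨h0, hm⟩ := (lab_pos_iff σ).1 h
    obtain ⟨i, rfl⟩ := exists_fin_of_mem h0 hm
    rw [lab_succ]
    omega

/-- Hence `lab σ.symm v` is the position of the label v, and is used in that sense throughout. -/
lemma lab_symm_lab (σ : Equiv.Perm (Fin m)) {x : ℕ} (hx : x ≤ m) : lab σ.symm (lab σ x) = x := by
  rcases Nat.eq_zero_or_pos x with rfl | h
  · rfl
  · obtain ⟨i, rfl⟩ := exists_fin_of_mem h hx
    rw [lab_succ, lab_succ, Equiv.symm_apply_apply]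

lemma lab_lab_symm (σ : Equiv.Perm (Fin m)) {x : ℕ} (hx : x ≤ m) : lab σ (lab σ.symm x) = x :=
  lab_symm_lab σ.symm hx

lemma lab_inj (σ : Equiv.Perm (Fin m)) {x y : ℕ} (hx : x ≤ m) (hy : y ≤ m) :
    lab σ x = lab σ y ↔ x = y :=
  ⟨fun h ↦ by rw [← lab_symm_lab σ hx, h, lab_symm_lab σ hy], fun h ↦ by rw [h]⟩

lemma lab_mul_swap (σ : Equiv.Perm (Fin m)) (i j : Fin m) (z : ℕ) :
    lab (σ * Equiv.swap i j) z = lab σ (Equiv.swap ((i : ℕ) + 1) ((j : ℕ) + 1) z) := by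
  rcases Nat.eq_zero_or_pos z with rfl | h0
  · rw [Equiv.swap_apply_of_ne_of_ne (by omega) (by omega)]
    rfl
  rcases Nat.lt_or_ge m z with h | h
  · rw [Equiv.swap_apply_of_ne_of_ne (by omega) (by omega), lab_of_lt _ h, lab_of_lt _ h]
  obtain ⟨x, rfl⟩ := exists_fin_of_mem h0 h
  rw [lab_succ, Equiv.Perm.mul_apply]
  have : Equiv.swap ((i : ℕ) + 1) ((j : ℕ) + 1) ((x : ℕ) + 1) = (Equiv.swap i j x : ℕ) + 1 := by
    simp only [Equiv.swap_apply_def, Fin.ext_iff, add_left_inj]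
    split_ifs <;> rfl
  rw [this, lab_succ]

/-- `H` does not change when two labels at positions in `W` are exchanged. -/
def SwapInvariant (W : Finset ℕ) (H : Equiv.Perm (Fin m) → ℝ) : Prop :=
  ∀ i j : Fin m, (i : ℕ) + 1 ∈ W → (j : ℕ) + 1 ∈ W → ∀ σ, H (σ * Equiv.swap i j) = H σ

lemma SwapInvariant.mono {W W' : Finset ℕ} {H : Equiv.Perm (Fin m) → ℝ} (h : SwapInvariant W H)
    (hW : W' ⊆ W) : SwapInvariant W' H :=
  fun i j hi hj ↦ h i j (hW hi) (hW hj)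

open Classical in
/-- The indicator of the event that position `b` carries the smallest of the labels in `W`. -/
noncomputable def argminInd (W : Finset ℕ) (b : ℕ) (σ : Equiv.Perm (Fin m)) : ℝ :=
  if ∀ z ∈ W, z ≠ b → lab σ b < lab σ z then 1 else 0

lemma sum_argminInd {W : Finset ℕ} (hW : W ⊆ Finset.Icc 1 m) (hne : W.Nonempty)
    (σ : Equiv.Perm (Fin m)) : ∑ b ∈ W, argminInd W b σ = 1 := by
  have hm : ∀ z ∈ W, z ≤ m := fun z hz ↦ (Finset.mem_Icc.1 (hW hz)).2
  obtain ⟨b, hb, hmin⟩ := W.exists_min_image (lab σ) hne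
  rw [Finset.sum_eq_single_of_mem b hb]
  · refine if_pos fun z hz hzb ↦ lt_of_le_of_ne (hmin z hz) fun h ↦ hzb ?_
    exact ((lab_inj σ (hm b hb) (hm z hz)).1 h).symm
  · intro c hc hcb
    refine if_neg fun h ↦ ?_
    have h1 := h b hb hcb.symm
    have h2 := hmin c hc
    omega

lemma argminInd_mul_swap {W : Finset ℕ} (i j : Fin m) (hi : (i : ℕ) + 1 ∈ W)
    (hj : (j : ℕ) + 1 ∈ W) (σ : Equiv.Perm (Fin m)) :
    argminInd W ((i : ℕ) + 1) (σ * Equiv.swap i j) = argminInd W ((j : ℕ) + 1) σ := by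
  have hsw : ∀ z ∈ W, Equiv.swap ((i : ℕ) + 1) ((j : ℕ) + 1) z ∈ W := by
    intro z hz
    rw [Equiv.swap_apply_def]
    split_ifs <;> assumption
  unfold argminInd
  congr 1
  simp only [lab_mul_swap, Equiv.swap_apply_left, eq_iff_iff]
  constructor
  · intro h z hz hzj
    have := h _ (hsw z hz) (fun hh ↦ hzj (by
      rw [Equiv.swap_apply_eq_iff, Equiv.swap_apply_left] at hh
      exact hh))
    rwa [Equiv.swap_apply_self] at this
  · intro h z hz hzi
    refine h _ (hsw z hz) fun hh ↦ hzi ?_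
    rw [Equiv.swap_apply_eq_iff, Equiv.swap_apply_right] at hh
    exact hh

/-- Each position in a window is equally likely to carry the smallest label, and this is
independent of everything that does not depend on the order within the window. -/
lemma expect_mul_argminInd {W : Finset ℕ} (hW : W ⊆ Finset.Icc 1 m)
    {H : Equiv.Perm (Fin m) → ℝ} (hH : SwapInvariant W H) {b : ℕ} (hb : b ∈ W) :
    𝔼 σ, H σ * argminInd W b σ = 1 / (W.card : ℝ) * 𝔼 σ, H σ := by
  have hfin : ∀ z ∈ W, ∃ i : Fin m, z = (i : ℕ) + 1 := fun z hz ↦ by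
    have := Finset.mem_Icc.1 (hW hz)
    exact exists_fin_of_mem (by omega) this.2
  -- Exchanging the labels at b and c permutes the arrangements, fixes H and moves the minimum from
  -- one position to the other.
  have hsame : ∀ c ∈ W, 𝔼 σ, H σ * argminInd W c σ = 𝔼 σ, H σ * argminInd W b σ := by
    intro c hc
    obtain ⟨i, rfl⟩ := hfin c hc
    obtain ⟨j, rfl⟩ := hfin b hb
    refine Fintype.expect_equiv (Equiv.mulRight (Equiv.swap j i)) _ _ fun σ ↦ ?_
    simp only [Equiv.coe_mulRight]
    rw [hH j i hb hc, argminInd_mul_swap j i hb hc]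
  have hsum : ∑ c ∈ W, 𝔼 σ, H σ * argminInd W c σ = 𝔼 σ, H σ := by
    rw [← Finset.expect_sum_comm]
    refine Finset.expect_congr rfl fun σ _ ↦ ?_
    rw [← Finset.mul_sum, sum_argminInd hW ⟨b, hb⟩, mul_one]
  rw [Finset.sum_congr rfl hsame, Finset.sum_const, nsmul_eq_mul] at hsum
  have hcard : (W.card : ℝ) ≠ 0 := by
    exact_mod_cast (Finset.card_pos.2 ⟨b, hb⟩).ne'
  rw [← hsum]
  field_simp

open Classical in
/-- The indicator of the event that the labels at the `k` positions after `j` are larger than the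
label at `j`. -/
noncomputable def runInd (k j : ℕ) (σ : Equiv.Perm (Fin m)) : ℝ :=
  if ∀ i, 1 ≤ i → i ≤ k → lab σ j < lab σ (j + i) then 1 else 0

/-- The probability of the event that the labels at the `k` positions after `j ≥ 1` are larger than
the label at `j`. -/
noncomputable def runProb (m k j : ℕ) : ℝ := if j + k ≤ m then 1 / ((k : ℝ) + 1) else 0

lemma expect_mul_runInd {k j : ℕ} (hj : 1 ≤ j) {H : Equiv.Perm (Fin m) → ℝ}
    (hjm : j ≤ m) (hH : SwapInvariant (Finset.Icc j (j + k)) H) :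
    𝔼 σ, H σ * runInd k j σ = runProb m k j * 𝔼 σ, H σ := by
  unfold runProb
  split_ifs with h
  · have hrun : ∀ σ : Equiv.Perm (Fin m), runInd k j σ = argminInd (Finset.Icc j (j + k)) j σ := by
      intro σ
      unfold runInd argminInd
      congr 1
      simp only [Finset.mem_Icc, eq_iff_iff]
      constructor
      · intro h z hz hzj
        have := h (z - j) (by omega) (by omega)
        rwa [show j + (z - j) = z by omega] at this
      · intro h i h1 hi
        exact h _ (by omega) (by omega)
    simp_rw [hrun]
    rw [expect_mul_argminInd (Finset.Icc_subset_Icc hj h) hH (by simp)]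
    simp [show j + k + 1 - j = k + 1 by omega]
  · have hrun : ∀ σ : Equiv.Perm (Fin m), runInd k j σ = 0 := by
      intro σ
      refine if_neg fun hh ↦ ?_
      -- The window overruns the arrangement; the default label 0 there is never larger, so the
      -- event is empty.
      have := hh k (by omega) le_rfl
      rw [lab_of_lt σ (by omega : m < j + k)] at this
      omega
    simp [hrun]

/-- `f` is a function of the labels at the positions in `W`. -/
def LabelsDetermine (W : Finset ℕ) (f : Equiv.Perm (Fin m) → ℝ) : Prop :=
  ∀ σ τ, (∀ z ∈ W, lab σ z = lab τ z) → f σ = f τ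

lemma labelsDetermine_runInd (k j : ℕ) :
    LabelsDetermine (Finset.Icc j (j + k)) (runInd (m := m) k j) := by
  intro σ τ h
  unfold runInd
  congr 1
  rw [eq_iff_iff]
  refine forall_congr' fun i ↦ forall_congr' fun h1 ↦ forall_congr' fun hk ↦ ?_
  rw [h j (by simp), h (j + i) (by simp; omega)]

lemma LabelsDetermine.mono {W W' : Finset ℕ} {f : Equiv.Perm (Fin m) → ℝ}
    (h : LabelsDetermine W f) (hW : W ⊆ W') : LabelsDetermine W' f :=
  fun σ τ hh ↦ h σ τ fun z hz ↦ hh z (hW hz)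

lemma LabelsDetermine.swapInvariant {W W' : Finset ℕ} {f : Equiv.Perm (Fin m) → ℝ}
    (h : LabelsDetermine W f) (hd : Disjoint W W') : SwapInvariant W' f := by
  intro i j hi hj σ
  refine h _ _ fun z hz ↦ ?_
  rw [lab_mul_swap, Equiv.swap_apply_of_ne_of_ne]
  · rintro rfl
    exact Finset.disjoint_left.1 hd hz hi
  · rintro rfl
    exact Finset.disjoint_left.1 hd hz hj

/-- Windows of length `w` at positions congruent modulo `w` are disjoint, which gives
independence. -/
lemma expect_prod_eq {w : ℕ} (X : ℕ → Equiv.Perm (Fin m) → ℝ) (q : ℕ → ℝ) (a : ℝ)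
    (hdet : ∀ j, LabelsDetermine (Finset.Ico j (j + w)) (X j))
    (hX : ∀ j ∈ Finset.Icc 1 m, ∀ H : Equiv.Perm (Fin m) → ℝ,
      SwapInvariant (Finset.Ico j (j + w)) H → 𝔼 σ, H σ * X j σ = q j * 𝔼 σ, H σ)
    (S : Finset ℕ) (hS : S ⊆ Finset.Icc 1 m) (r : ℕ) (hr : ∀ j ∈ S, j % w = r) :
    𝔼 σ, ∏ j ∈ S, (1 + a * X j σ) = ∏ j ∈ S, (1 + a * q j) := by
  induction S using Finset.induction_on with
  | empty => simp
  | insert b S hb ih =>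
    have hinv : SwapInvariant (Finset.Ico b (b + w)) (fun σ ↦ ∏ j ∈ S, (1 + a * X j σ)) := by
      intro x y hx hy σ
      refine Finset.prod_congr rfl fun j hj ↦ ?_
      rw [(hdet j).swapInvariant (W' := Finset.Ico b (b + w)) ?_ x y hx hy]
      have hne : j ≠ b := fun h ↦ hb (h ▸ hj)
      have hmod : j ≡ b [MOD w] := (hr j (Finset.mem_insert_of_mem hj)).trans
        (hr b (Finset.mem_insert_self _ _)).symm
      have hfar : j + w ≤ b ∨ b + w ≤ j := by
        rcases Nat.lt_or_gt_of_ne hne with h | h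
        · left
          have := Nat.le_of_dvd (by omega) ((Nat.modEq_iff_dvd' h.le).1 hmod)
          omega
        · right
          have := Nat.le_of_dvd (by omega) ((Nat.modEq_iff_dvd' h.le).1 hmod.symm)
          omega
      rw [Finset.disjoint_left]
      intro z hz hz'
      rw [Finset.mem_Ico] at hz hz'
      omega
    have hstep := hX b (hS (Finset.mem_insert_self _ _)) _ hinv
    simp_rw [Finset.prod_insert hb]
    rw [← ih (fun j hj ↦ hS (Finset.mem_insert_of_mem hj))
      (fun j hj ↦ hr j (Finset.mem_insert_of_mem hj))]
    calc 𝔼 σ, (1 + a * X b σ) * ∏ j ∈ S, (1 + a * X j σ)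
        = 𝔼 σ, ((∏ j ∈ S, (1 + a * X j σ)) + a * ((∏ j ∈ S, (1 + a * X j σ)) * X b σ)) :=
          Finset.expect_congr rfl fun σ _ ↦ by ring
      _ = _ := by
          rw [Finset.expect_add_distrib, ← Finset.mul_expect, hstep]
          ring

end Labels

/-! ### The bijection between arrangements and recursive trees -/

section Correspondence

open scoped BigOperators

variable {m : ℕ}

/-- The label of the last position before that of `u` whose label is smaller than `u`. -/
def precedingSmaller (σ : Equiv.Perm (Fin m)) (u : ℕ) : ℕ :=
  lab σ (Nat.findGreatest (fun y ↦ lab σ y < u) (lab σ.symm u))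

lemma precedingSmaller_lt (σ : Equiv.Perm (Fin m)) {u : ℕ} (hu : 0 < u) :
    precedingSmaller σ u < u :=
  Nat.findGreatest_spec (P := fun y ↦ lab σ y < u) (Nat.zero_le _) (by simpa using hu)

/-- The recursive tree whose preorder traversal, later children first, is the arrangement of
labels given by `σ`. -/
def treeOf (σ : Equiv.Perm (Fin m)) : History (m + 1) :=
  fun i ↦ ⟨precedingSmaller σ ((i : ℕ) + 1), precedingSmaller_lt σ (Nat.succ_pos _)⟩

lemma isParent_treeOf (σ : Equiv.Perm (Fin m)) {v u : ℕ} :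
    IsParent (treeOf σ) v u ↔ 0 < u ∧ u ≤ m ∧ v = precedingSmaller σ u := by
  constructor
  · rintro ⟨i, rfl, rfl⟩
    have := i.isLt
    exact ⟨by omega, by omega, rfl⟩
  · rintro ⟨h0, hm, rfl⟩
    obtain ⟨i, rfl⟩ := exists_fin_of_mem h0 hm
    exact ⟨i, rfl, rfl⟩

lemma position_precedingSmaller (σ : Equiv.Perm (Fin m)) {u : ℕ} (h0 : 0 < u) (hm : u ≤ m) :
    lab σ.symm (precedingSmaller σ u) < lab σ.symm u ∧
      ∀ y, lab σ.symm (precedingSmaller σ u) < y → y < lab σ.symm u → u < lab σ y := by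
  set g := Nat.findGreatest (fun y ↦ lab σ y < u) (lab σ.symm u) with hg
  have hgle : g ≤ lab σ.symm u := Nat.findGreatest_le _
  have hgu : lab σ g < u := precedingSmaller_lt σ h0
  have hpos : lab σ.symm (precedingSmaller σ u) = g :=
    lab_symm_lab σ (hgle.trans (lab_le _ _))
  rw [hpos]
  refine ⟨lt_of_le_of_ne hgle fun h ↦ ?_, fun y hy1 hy2 ↦ ?_⟩
  · rw [h, lab_lab_symm σ hm] at hgu
    omega
  · have h1 := Nat.findGreatest_is_greatest hy1 hy2.le
    refine lt_of_le_of_ne (not_lt.1 h1) fun h ↦ ?_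
    have h2 : lab σ.symm u = y := by
      rw [h]
      exact lab_symm_lab σ (hy2.le.trans (lab_le _ _))
    omega

/-- Each step to a parent jumps left over larger labels only, so a chain from u to v crosses no
label below v. Conversely, the parent of u cannot lie to the left of v, as v < u would then be
jumped over; one recurses on the parent. -/
lemma isDescendant_treeOf (σ : Equiv.Perm (Fin m)) {v u : ℕ} (hv : v ≤ m) (hu : u ≤ m) :
    IsDescendant (treeOf σ) v u ↔ lab σ.symm v < lab σ.symm u ∧
      ∀ y, lab σ.symm v < y → y ≤ lab σ.symm u → v < lab σ y := by
  constructor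
  · have hpar : ∀ {a b}, IsParent (treeOf σ) a b → lab σ.symm a < lab σ.symm b ∧
        ∀ y, lab σ.symm a < y → y ≤ lab σ.symm b → a < lab σ y := by
      intro a b hab
      obtain ⟨h0, hm, rfl⟩ := (isParent_treeOf σ).1 hab
      obtain ⟨h1, h2⟩ := position_precedingSmaller σ h0 hm
      refine ⟨h1, fun y hy1 hy2 ↦ ?_⟩
      have hlt := precedingSmaller_lt σ h0
      rcases hy2.lt_or_eq with h | h
      · exact hlt.trans (h2 y hy1 h)
      · rw [h, lab_lab_symm σ hm]
        exact hlt
    intro h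
    clear hu
    induction h with
    | single h => exact hpar h
    | @tail b c hb hbc ih =>
      obtain ⟨h1, h2⟩ := hpar hbc
      refine ⟨ih.1.trans h1, fun y hy1 hy2 ↦ ?_⟩
      rcases Nat.lt_or_ge (lab σ.symm b) y with h | h
      · have hbm : b ≤ m := by
          obtain ⟨h0, hm, rfl⟩ := (isParent_treeOf σ).1 hbc
          exact (precedingSmaller_lt σ h0).le.trans hm
        have hvb := ih.2 _ ih.1 le_rfl
        rw [lab_lab_symm σ hbm] at hvb
        exact hvb.trans (h2 y h hy2)
      · exact ih.2 y hy1 h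
  · induction u using Nat.strong_induction_on with
    | _ u ih =>
      rintro ⟨h1, h2⟩
      have hvu : v < u := by
        have := h2 _ h1 le_rfl
        rwa [lab_lab_symm σ hu] at this
      have h0 : 0 < u := by omega
      obtain ⟨h3, h4⟩ := position_precedingSmaller σ h0 hu
      have hlt := precedingSmaller_lt σ h0
      have hpar : IsParent (treeOf σ) (precedingSmaller σ u) u :=
        (isParent_treeOf σ).2 ⟨h0, hu, rfl⟩
      rcases lt_trichotomy (lab σ.symm (precedingSmaller σ u)) (lab σ.symm v) with h | h | h
      · have := h4 _ h h1
        rw [lab_lab_symm σ hv] at this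
        omega
      · rw [lab_inj σ.symm (by omega) hv] at h
        rw [h] at hpar
        exact Relation.TransGen.single hpar
      · exact (ih _ hlt (by omega) ⟨h, fun y hy1 hy2 ↦ h2 y hy1 (by omega)⟩).tail hpar

lemma le_numDescendants_treeOf (σ : Equiv.Perm (Fin m)) {v : ℕ} (hv : v ≤ m) (k : ℕ) :
    k ≤ numDescendants (treeOf σ) v ↔ ∀ i, 1 ≤ i → i ≤ k → v < lab σ (lab σ.symm v + i) := by
  classical
  unfold numDescendants
  set P := lab σ.symm v with hP
  constructor
  · intro hk
    by_contra! hcon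
    obtain ⟨i, h1, hik, hi⟩ := hcon
    -- A label at offset i that is not larger (possibly the default 0) ends the subtree, leaving at
    -- most i - 1 < k descendants.
    have hsub : (Finset.range (m + 1)).filter (fun u ↦ IsDescendant (treeOf σ) v u) ⊆
        (Finset.Ioo P (P + i)).image (lab σ) := by
      intro u hu
      rw [Finset.mem_filter, Finset.mem_range] at hu
      have hum : u ≤ m := by omega
      obtain ⟨h2, h3⟩ := (isDescendant_treeOf σ hv hum).1 hu.2
      refine Finset.mem_image.2 ⟨lab σ.symm u, ?_, lab_lab_symm σ hum⟩
      rw [Finset.mem_Ioo]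
      refine ⟨h2, ?_⟩
      by_contra hge
      have := h3 (P + i) (by omega) (by omega)
      omega
    have h2 := Finset.card_le_card hsub
    have h3 := (Finset.card_image_le (s := Finset.Ioo P (P + i)) (f := lab σ))
    rw [Nat.card_Ioo] at h3
    have h4 : k ≤ ((Finset.range (m + 1)).filter
      (fun u ↦ IsDescendant (treeOf σ) v u)).card := by convert hk
    omega
  · intro h
    have hle : ∀ i, 1 ≤ i → i ≤ k → P + i ≤ m := fun i h1 hi ↦
      ((lab_pos_iff σ).1 (by have := h i h1 hi; omega)).2
    have hcard : ((Finset.Icc 1 k).image fun i ↦ lab σ (P + i)).card = k := by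
      rw [Finset.card_image_of_injOn, Nat.card_Icc, Nat.add_sub_cancel]
      intro i hi j hj hij
      simp only [Finset.coe_Icc, Set.mem_Icc] at hi hj
      have := (lab_inj σ (hle i hi.1 hi.2) (hle j hj.1 hj.2)).1 hij
      omega
    rw [← hcard]
    refine Finset.card_le_card fun u hu ↦ ?_
    obtain ⟨i, hi, rfl⟩ := Finset.mem_image.1 hu
    rw [Finset.mem_Icc] at hi
    have hm := lab_le σ (P + i)
    rw [Finset.mem_filter, Finset.mem_range]
    refine ⟨by omega, (isDescendant_treeOf σ hv hm).2 ?_⟩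
    rw [lab_symm_lab σ (hle i hi.1 hi.2)]
    refine ⟨by omega, fun y hy1 hy2 ↦ ?_⟩
    have := h (y - P) (by omega) (by omega)
    rwa [show P + (y - P) = y by omega] at this

/-- Among the labels up to N + 1, the label N + 1 stands immediately after its parent. So the
parents determine the relative order of the labels by induction on N. -/
lemma treeOf_injective : Function.Injective (treeOf : Equiv.Perm (Fin m) → History (m + 1)) := by
  intro σ τ h
  have hsm : ∀ u, 0 < u → u ≤ m → precedingSmaller σ u = precedingSmaller τ u := by
    intro u h0 hm
    obtain ⟨i, rfl⟩ := exists_fin_of_mem h0 hm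
    exact congrArg Fin.val (congrFun h i)
  -- A vertex comes before a later vertex `u` exactly if it does not come after the parent of `u`.
  have hbefore : ∀ (ρ : Equiv.Perm (Fin m)) (x u : ℕ), x < u → u ≤ m →
      (lab ρ.symm x < lab ρ.symm u ↔ ¬ lab ρ.symm (precedingSmaller ρ u) < lab ρ.symm x) := by
    intro ρ x u hxu hu
    obtain ⟨h1, h2⟩ := position_precedingSmaller ρ (by omega : 0 < u) hu
    constructor
    · intro h3 h4
      have := h2 _ h4 h3
      rw [lab_lab_symm ρ (by omega)] at this
      omega
    · intro h3
      omega
  have horder : ∀ N, N ≤ m → ∀ x ≤ N, ∀ y ≤ N,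
      (lab σ.symm x < lab σ.symm y ↔ lab τ.symm x < lab τ.symm y) := by
    intro N
    induction N with
    | zero =>
      intro _ x hx y hy
      obtain rfl : x = 0 := by omega
      obtain rfl : y = 0 := by omega
      simp
    | succ N ih =>
      intro hN
      have hlast : ∀ x ≤ N, (lab σ.symm x < lab σ.symm (N + 1) ↔
          lab τ.symm x < lab τ.symm (N + 1)) := by
        intro x hx
        have hp : precedingSmaller τ (N + 1) < N + 1 := precedingSmaller_lt τ (Nat.succ_pos N)
        rw [hbefore σ x _ (by omega) hN, hbefore τ x _ (by omega) hN, hsm _ (by omega) hN,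
          ih (by omega) _ (by omega) x hx]
      intro x hx y hy
      rcases Nat.lt_or_ge N x with hx' | hx' <;> rcases Nat.lt_or_ge N y with hy' | hy'
      · obtain rfl : x = N + 1 := by omega
        obtain rfl : y = N + 1 := by omega
        simp
      · obtain rfl : x = N + 1 := by omega
        have h1 := hlast y hy'
        have h2 : ∀ ρ : Equiv.Perm (Fin m), lab ρ.symm y ≠ lab ρ.symm (N + 1) := fun ρ hh ↦ by
          have := (lab_inj ρ.symm (by omega) hN).1 hh
          omega
        have h3 := h2 σ
        have h4 := h2 τ
        omega
      · obtain rfl : y = N + 1 := by omega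
        exact hlast x hx'
      · exact ih (by omega) x hx' y hy'
  have hmono : StrictMono (fun i ↦ τ.symm (σ i)) := by
    intro i j hij
    have h1 := (horder m le_rfl (σ i + 1) (by omega) (σ j + 1) (by omega)).1 (by
      rw [lab_succ, lab_succ]
      simpa using hij)
    rw [lab_succ, lab_succ] at h1
    simpa using h1
  -- A finite chain has no order automorphism but the identity.
  have hid : hmono.orderIsoOfSurjective _ (σ.trans τ.symm).surjective = OrderIso.refl _ :=
    Subsingleton.elim _ _
  ext i
  have hi : τ.symm (σ i) = i := DFunLike.congr_fun hid i
  rw [(Equiv.symm_apply_eq τ).1 hi]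

lemma card_history (m : ℕ) : Fintype.card (History (m + 1)) = m.factorial := by
  rw [Fintype.card_pi]
  simp only [Fintype.card_fin]
  exact (Fin.prod_univ_eq_prod_range (fun i ↦ i + 1) m).trans
    (Finset.prod_range_add_one_eq_factorial m)

lemma treeOf_bijective : Function.Bijective (treeOf : Equiv.Perm (Fin m) → History (m + 1)) := by
  rw [Fintype.bijective_iff_injective_and_card]
  exact ⟨treeOf_injective, by rw [card_history, Fintype.card_perm, Fintype.card_fin]⟩

lemma expect_history_eq (f : History (m + 1) → ℝ) : 𝔼 p, f p = 𝔼 σ, f (treeOf σ) :=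
  (Fintype.expect_bijective treeOf treeOf_bijective _ _ fun _ ↦ rfl).symm

lemma M_treeOf (k : ℕ) (σ : Equiv.Perm (Fin m)) :
    (M k (m + 1) (treeOf σ) : ℝ) = ∑ j ∈ Finset.range (m + 1), runInd k j σ := by
  classical
  unfold M
  rw [Finset.card_filter]
  push_cast
  refine Finset.sum_nbij' (lab σ.symm) (lab σ) ?_ ?_ ?_ ?_ ?_
  · intro v _
    have := lab_le σ.symm v
    simp only [Finset.mem_range]
    omega
  · intro x _
    have := lab_le σ x
    simp only [Finset.mem_range]
    omega
  · intro v hv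
    rw [Finset.mem_range] at hv
    exact lab_lab_symm σ (by omega)
  · intro x hx
    rw [Finset.mem_range] at hx
    exact lab_symm_lab σ (by omega)
  · intro v hv
    rw [Finset.mem_range] at hv
    unfold runInd
    simp only [lab_lab_symm σ (by omega : v ≤ m), le_numDescendants_treeOf σ (by omega : v ≤ m)]

lemma L_add_M_succ (k n : ℕ) (p : History n) : L k n p + M (k + 1) n p = M k n p := by
  unfold L M
  rw [← Finset.card_union_of_disjoint]
  · congr 1
    ext v
    simp only [Finset.mem_union, Finset.mem_filter]
    constructor
    · rintro (⟨h, h'⟩ | ⟨h, h'⟩) <;> exact ⟨h, by omega⟩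
    · rintro ⟨h, h'⟩
      rcases Nat.eq_or_lt_of_le h' with h2 | h2
      · exact Or.inl ⟨h, h2.symm⟩
      · exact Or.inr ⟨h, h2⟩
  · rw [Finset.disjoint_left]
    intro v h h'
    simp only [Finset.mem_filter] at h h'
    omega

lemma runInd_position_zero {k : ℕ} (hk : k ≤ m) (σ : Equiv.Perm (Fin m)) : runInd k 0 σ = 1 := by
  refine if_pos fun i h1 hi ↦ ?_
  rw [lab_zero, lab_pos_iff]
  omega

lemma M_treeOf_eq {k : ℕ} (hk : k ≤ m) (σ : Equiv.Perm (Fin m)) :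
    (M k (m + 1) (treeOf σ) : ℝ) = 1 + ∑ j ∈ Finset.Icc 1 m, runInd k j σ := by
  rw [M_treeOf, Finset.range_eq_Ico, Finset.sum_eq_sum_Ico_succ_bot (Nat.succ_pos m),
    runInd_position_zero hk]
  rfl

/-- The root, at position 0, counts in both M k and M (k + 1) because k + 1 ≤ m, so it cancels. -/
lemma L_treeOf_eq {k : ℕ} (hk : k + 1 ≤ m) (σ : Equiv.Perm (Fin m)) :
    (L k (m + 1) (treeOf σ) : ℝ) =
      ∑ j ∈ Finset.Icc 1 m, (runInd k j σ - runInd (k + 1) j σ) := by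
  have h : (L k (m + 1) (treeOf σ) : ℝ) + M (k + 1) (m + 1) (treeOf σ) = M k (m + 1) (treeOf σ) := by
    exact_mod_cast L_add_M_succ k (m + 1) (treeOf σ)
  rw [M_treeOf_eq hk, M_treeOf_eq (by omega)] at h
  rw [Finset.sum_sub_distrib]
  linarith

end Correspondence

/-! ### The law of the tree as a finite average -/

section Law

open scoped BigOperators

lemma uniformLaw_real_singleton (n : ℕ) (p : History n) :
    (uniformLaw n).real {p} = 1 / (Fintype.card (History n) : ℝ) := by
  rw [Measure.real, uniformLaw, Measure.pi_singleton]
  simp only [ENNReal.toReal_prod, Fintype.card_pi]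
  simp [ENNReal.toReal_add]

instance (n : ℕ) : IsProbabilityMeasure (uniformLaw n) := by
  unfold uniformLaw
  infer_instance

lemma integral_uniformLaw (n : ℕ) (f : History n → ℝ) : ∫ p, f p ∂(uniformLaw n) = 𝔼 p, f p := by
  rw [integral_fintype Integrable.of_finite, Fintype.expect_eq_sum_div_card]
  simp_rw [uniformLaw_real_singleton, smul_eq_mul, ← Finset.mul_sum]
  ring

open Classical in
lemma uniformLaw_real_setOf (n : ℕ) (P : History n → Prop) :
    (uniformLaw n).real {p | P p} = 𝔼 p, (if P p then (1 : ℝ) else 0) := by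
  rw [← integral_uniformLaw, ← integral_indicator_one (Set.toFinite _).measurableSet]
  rfl

end Law

/-! ### The number of non-leaves: a martingale argument -/

section Leaves

open scoped BigOperators

/-- Hoeffding's lemma for the uniform law on a finite type. -/
lemma expect_exp_le_of_mem_Icc {Ω : Type*} [Fintype Ω] [Nonempty Ω] (X : Ω → ℝ)
    (hX : ∀ ω, X ω ∈ Set.Icc (0 : ℝ) 1) (a : ℝ) :
    𝔼 ω, Real.exp (a * (X ω - 𝔼 ω', X ω')) ≤ Real.exp (a ^ 2 / 8) := by
  let _ : MeasurableSpace Ω := ⊤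
  set μ : Measure Ω := (PMF.uniformOfFintype Ω).toMeasure with hμ
  have hint : ∀ f : Ω → ℝ, ∫ ω, f ω ∂μ = 𝔼 ω, f ω := by
    intro f
    rw [integral_fintype Integrable.of_finite, Fintype.expect_eq_sum_div_card, Finset.sum_div]
    refine Finset.sum_congr rfl fun ω _ ↦ ?_
    rw [Measure.real, hμ, PMF.toMeasure_apply_singleton _ _ MeasurableSpace.measurableSet_top]
    simp [div_eq_inv_mul]
  have h := (ProbabilityTheory.hasSubgaussianMGF_of_mem_Icc (μ := μ) (X := X) (a := 0) (b := 1)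
    (measurable_from_top.aemeasurable) (Filter.Eventually.of_forall hX)).mgf_le a
  rw [ProbabilityTheory.mgf, hint, hint] at h
  refine h.trans (le_of_eq ?_)
  congr 1
  simp
  ring

/-- The set of vertices which are the parent of some vertex. -/
def parents {m : ℕ} (p : (i : Fin m) → Fin ((i : ℕ) + 1)) : Finset ℕ :=
  Finset.univ.image fun i ↦ (p i : ℕ)

lemma parents_snoc {m : ℕ} (v : Fin (m + 1)) (p : (i : Fin m) → Fin ((i : ℕ) + 1)) :
    parents (Fin.snocEquiv (fun i : Fin (m + 1) ↦ Fin ((i : ℕ) + 1)) (v, p)) =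
      insert (v : ℕ) (parents p) := by
  ext x
  simp only [parents, Finset.mem_image, Finset.mem_univ, true_and, Finset.mem_insert,
    Fin.exists_fin_succ', Fin.snocEquiv_apply, Fin.snoc_castSucc, Fin.snoc_last]
  rw [or_comm, eq_comm (a := x)]

lemma parents_subset {m : ℕ} (p : (i : Fin m) → Fin ((i : ℕ) + 1)) :
    parents p ⊆ Finset.range m := by
  intro x hx
  obtain ⟨i, _, rfl⟩ := Finset.mem_image.1 hx
  have := (p i).isLt
  rw [Finset.mem_range]
  omega

lemma expect_snoc {m : ℕ} (f : ((i : Fin (m + 1)) → Fin ((i : ℕ) + 1)) → ℝ) :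
    𝔼 p, f p = 𝔼 p : ((i : Fin m) → Fin ((i : ℕ) + 1)), 𝔼 v : Fin (m + 1),
      f (Fin.snocEquiv (fun i : Fin (m + 1) ↦ Fin ((i : ℕ) + 1)) (v, p)) := by
  rw [← Fintype.expect_equiv (Fin.snocEquiv (fun i : Fin (m + 1) ↦ Fin ((i : ℕ) + 1)))
    (fun x ↦ f (Fin.snocEquiv (fun i : Fin (m + 1) ↦ Fin ((i : ℕ) + 1)) x)) f (fun _ ↦ rfl)]
  rw [Finset.expect_comm]
  exact Finset.expect_product Finset.univ Finset.univ
    (fun x : Fin (m + 1) × ((i : Fin m) → Fin ((i : ℕ) + 1)) ↦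
      f (Fin.snocEquiv (fun i : Fin (m + 1) ↦ Fin ((i : ℕ) + 1)) x))

/-- With P parents after m choices, m (P - (m + 1)/2) is a martingale. Its next increment is m + 1
times the centred indicator that the chosen vertex was a leaf, to which Hoeffding's lemma applies.
-/
lemma expect_exp_parents_step {m : ℕ} (p : (i : Fin m) → Fin ((i : ℕ) + 1)) (s : ℝ) :
    𝔼 v : Fin (m + 1), Real.exp (s * (((m : ℝ) + 1) *
      (((insert (v : ℕ) (parents p)).card : ℝ) - ((m : ℝ) + 2) / 2))) ≤
      Real.exp (s * (m * ((parents p).card - ((m : ℝ) + 1) / 2))) *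
        Real.exp (s ^ 2 * ((m : ℝ) + 1) ^ 2 / 8) := by
  set X : Fin (m + 1) → ℝ := fun v ↦ if (v : ℕ) ∈ parents p then 0 else 1 with hX
  have hcard : ∀ v : Fin (m + 1),
      ((insert (v : ℕ) (parents p)).card : ℝ) = (parents p).card + X v := by
    intro v
    simp only [hX]
    split_ifs with h
    · rw [Finset.insert_eq_self.2 h, add_zero]
    · rw [Finset.card_insert_of_notMem h]
      push_cast
      ring
  have hmean : 𝔼 v, X v = ((m : ℝ) + 1 - (parents p).card) / (m + 1) := by
    rw [Fintype.expect_eq_sum_div_card, Fintype.card_fin]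
    have h1 : ∑ v, X v = ∑ v ∈ Finset.range (m + 1), if v ∈ parents p then (0 : ℝ) else 1 :=
      Fin.sum_univ_eq_sum_range (fun v ↦ if v ∈ parents p then (0 : ℝ) else 1) (m + 1)
    have h2 : ∑ v ∈ Finset.range (m + 1), (if v ∈ parents p then (0 : ℝ) else 1) +
        ∑ v ∈ Finset.range (m + 1), (if v ∈ parents p then (1 : ℝ) else 0) = m + 1 := by
      rw [← Finset.sum_add_distrib]
      have : ∀ v, ((if v ∈ parents p then (0 : ℝ) else 1) +
          if v ∈ parents p then (1 : ℝ) else 0) = 1 := by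
        intro v
        split_ifs <;> norm_num
      simp [this]
    have h3 : ∑ v ∈ Finset.range (m + 1), (if v ∈ parents p then (1 : ℝ) else 0) =
        (parents p).card := by
      rw [Finset.sum_boole, Finset.filter_mem_eq_inter, Finset.inter_eq_right.2
        ((parents_subset p).trans (Finset.range_subset_range.2 (Nat.le_succ m)))]
    rw [h1]
    push_cast
    congr 1
    linarith
  have hH := expect_exp_le_of_mem_Icc X (fun v ↦ by simp only [hX]; split_ifs <;> simp)
    (s * ((m : ℝ) + 1))
  rw [hmean] at hH
  have hm : (m : ℝ) + 1 ≠ 0 := by positivity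
  have hexp : ∀ v : Fin (m + 1), Real.exp (s * (((m : ℝ) + 1) *
      (((insert (v : ℕ) (parents p)).card : ℝ) - ((m : ℝ) + 2) / 2))) =
      Real.exp (s * (m * ((parents p).card - ((m : ℝ) + 1) / 2))) *
        Real.exp (s * ((m : ℝ) + 1) * (X v - ((m : ℝ) + 1 - (parents p).card) / (m + 1))) := by
    intro v
    rw [hcard, ← Real.exp_add]
    congr 1
    field_simp
    ring
  simp_rw [hexp]
  rw [← Finset.mul_expect]
  refine mul_le_mul_of_nonneg_left (hH.trans (le_of_eq ?_)) (Real.exp_pos _).le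
  congr 1
  ring

/-- The factor m²(m + 1)/2 bounds 1² + … + m²; in this form m² cancels on taking s = u/m. -/
lemma expect_exp_parents_le (m : ℕ) (s : ℝ) :
    𝔼 p : ((i : Fin m) → Fin ((i : ℕ) + 1)),
      Real.exp (s * (m * ((parents p).card - ((m : ℝ) + 1) / 2))) ≤
        Real.exp (s ^ 2 * ((m : ℝ) ^ 2 * (m + 1) / 2) / 8) := by
  induction m with
  | zero => simp
  | succ m ih =>
    rw [expect_snoc]
    simp only [parents_snoc]
    push_cast
    have hstep := fun p : ((i : Fin m) → Fin ((i : ℕ) + 1)) ↦ expect_exp_parents_step p s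
    have h2 : (m : ℝ) + 1 + 1 = m + 2 := by ring
    simp only [h2]
    refine (Finset.expect_le_expect fun p _ ↦ hstep p).trans ?_
    rw [← Finset.expect_mul]
    refine (mul_le_mul_of_nonneg_right ih (Real.exp_pos _).le).trans ?_
    rw [← Real.exp_add, Real.exp_le_exp]
    have : (0 : ℝ) ≤ m * s ^ 2 := by positivity
    nlinarith

lemma M_one_eq {m : ℕ} (p : History (m + 1)) :
    M 1 (m + 1) p = (parents (m := m) p).card := by
  classical
  unfold M
  congr 1
  ext v
  rw [Finset.mem_filter, Nat.one_le_iff_ne_zero, ← Nat.pos_iff_ne_zero, numDescendants,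
    Finset.card_pos]
  constructor
  · rintro ⟨_, u, hu⟩
    obtain ⟨_, hu⟩ := Finset.mem_filter.1 hu
    obtain ⟨w, ⟨i, _, hi⟩, _⟩ := Relation.TransGen.head'_iff.1 hu
    exact Finset.mem_image.2 ⟨i, Finset.mem_univ _, hi.symm⟩
  · intro hv
    have hvm := Finset.mem_range.1 (parents_subset (m := m) p hv)
    obtain ⟨i, _, hi⟩ := Finset.mem_image.1 hv
    refine ⟨Finset.mem_range.2 (by omega), (i : ℕ) + 1, Finset.mem_filter.2 ⟨?_, ?_⟩⟩
    · rw [Finset.mem_range]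
      omega
    · exact Relation.TransGen.single ⟨i, rfl, hi.symm⟩

lemma expect_exp_M_one_le {m : ℕ} (hm : 1 ≤ m) (u : ℝ) :
    𝔼 p : History (m + 1), Real.exp (u * ((M 1 (m + 1) p : ℝ) - ((m : ℝ) + 1) / 2)) ≤
      Real.exp (u ^ 2 * ((m : ℝ) + 1) / 16) := by
  have hm' : (m : ℝ) ≠ 0 := by positivity
  have h := expect_exp_parents_le m (u / m)
  simp_rw [M_one_eq]
  have h1 : ∀ y : ℝ, u / m * (m * y) = u * y := fun y ↦ by field_simp
  have h2 : (u / m) ^ 2 * ((m : ℝ) ^ 2 * (m + 1) / 2) / 8 = u ^ 2 * ((m : ℝ) + 1) / 16 := by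
    field_simp
    ring
  simp_rw [h1, h2] at h
  exact h

open Classical in
lemma M_one_lower_tail {m : ℕ} (hm : 1 ≤ m) {t : ℝ} (ht : 0 < t) :
    (uniformLaw (m + 1)).real {p | (M 1 (m + 1) p : ℝ) ≤ ((m : ℝ) + 1) / 2 - t} ≤
      Real.exp (-(4 * t ^ 2 / ((m : ℝ) + 1))) := by
  rw [uniformLaw_real_setOf]
  -- The minimiser of u²(m + 1)/16 - u t.
  set u := 8 * t / ((m : ℝ) + 1) with hu
  have hu0 : 0 < u := by positivity
  refine (expect_ite_le_exp_mul (fun p ↦ -u * ((M 1 (m + 1) p : ℝ) - ((m : ℝ) + 1) / 2)) _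
    (u * t) fun p hp ↦ ?_).trans ?_
  · nlinarith
  refine (mul_le_mul_of_nonneg_left (expect_exp_M_one_le hm (-u)) (Real.exp_pos _).le).trans ?_
  rw [← Real.exp_add, Real.exp_le_exp]
  refine le_of_eq ?_
  rw [hu]
  field_simp
  ring

open Classical in
lemma M_one_upper_tail {m : ℕ} (hm : 1 ≤ m) {t : ℝ} (ht : 0 < t) :
    (uniformLaw (m + 1)).real {p | ((m : ℝ) + 1) / 2 + t ≤ (M 1 (m + 1) p : ℝ)} ≤
      Real.exp (-(4 * t ^ 2 / ((m : ℝ) + 1))) := by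
  rw [uniformLaw_real_setOf]
  set u := 8 * t / ((m : ℝ) + 1) with hu
  have hu0 : 0 < u := by positivity
  refine (expect_ite_le_exp_mul (fun p ↦ u * ((M 1 (m + 1) p : ℝ) - ((m : ℝ) + 1) / 2)) _
    (u * t) fun p hp ↦ ?_).trans ?_
  · nlinarith
  refine (mul_le_mul_of_nonneg_left (expect_exp_M_one_le hm u) (Real.exp_pos _).le).trans ?_
  rw [← Real.exp_add, Real.exp_le_exp]
  refine le_of_eq ?_
  rw [hu]
  field_simp
  ring

lemma L_zero_eq {m : ℕ} (p : History (m + 1)) :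
    (L 0 (m + 1) p : ℝ) = (m : ℝ) + 1 - M 1 (m + 1) p := by
  have h := L_add_M_succ 0 (m + 1) p
  have h0 : M 0 (m + 1) p = m + 1 := by simp [M]
  rw [h0] at h
  have h' : (L 0 (m + 1) p : ℝ) + M 1 (m + 1) p = (m : ℝ) + 1 := by exact_mod_cast h
  linarith

end Leaves

/-! ### Means and exponential moments of the run counts -/

section Runs

open scoped BigOperators

variable {m : ℕ}

lemma runInd_eq_zero_or_one (k j : ℕ) (σ : Equiv.Perm (Fin m)) :
    runInd k j σ = 0 ∨ runInd k j σ = 1 := by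
  unfold runInd
  split_ifs <;> simp

lemma runInd_sub_eq_zero_or_one (k j : ℕ) (σ : Equiv.Perm (Fin m)) :
    runInd k j σ - runInd (k + 1) j σ = 0 ∨ runInd k j σ - runInd (k + 1) j σ = 1 := by
  unfold runInd
  split_ifs with h1 h2 h2
  · simp
  · simp
  · exact absurd (fun i hi hk ↦ h2 i hi (by omega)) h1
  · simp

lemma runProb_nonneg (m k j : ℕ) : 0 ≤ runProb m k j := by
  unfold runProb
  split_ifs <;> positivity

lemma runProb_le_one (m k j : ℕ) : runProb m k j ≤ 1 := by
  unfold runProb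
  split_ifs
  · rw [div_le_one (by positivity)]
    linarith [k.cast_nonneg (α := ℝ)]
  · norm_num

lemma runProb_succ_le (m k j : ℕ) : runProb m (k + 1) j ≤ runProb m k j := by
  unfold runProb
  split_ifs with h1 h2
  · push_cast
    gcongr
    linarith
  · omega
  · positivity
  · rfl

lemma sum_runProb {k : ℕ} (hk : k ≤ m) :
    ∑ j ∈ Finset.Icc 1 m, runProb m k j = ((m : ℝ) - k) / (k + 1) := by
  unfold runProb
  rw [← Finset.sum_filter]
  have : (Finset.Icc 1 m).filter (fun j ↦ j + k ≤ m) = Finset.Icc 1 (m - k) := by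
    ext j
    simp only [Finset.mem_filter, Finset.mem_Icc]
    omega
  rw [this, Finset.sum_const, Nat.card_Icc, nsmul_eq_mul, Nat.add_sub_cancel, Nat.cast_sub hk]
  ring

/-- The end effects cancel: (m - k)(k + 2) - (m - k - 1)(k + 1) = m + 1, which is why the mean of L
is exact. -/
lemma sum_runProb_sub {k : ℕ} (hk : k + 1 ≤ m) :
    ∑ j ∈ Finset.Icc 1 m, (runProb m k j - runProb m (k + 1) j) =
      ((m : ℝ) + 1) / ((k + 1) * (k + 2)) := by
  rw [Finset.sum_sub_distrib, sum_runProb (by omega), sum_runProb hk]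
  push_cast
  field_simp
  ring

lemma Icc_eq_Ico_window (k j : ℕ) : Finset.Icc j (j + k) = Finset.Ico j (j + (k + 1)) := by
  ext x
  simp only [Finset.mem_Icc, Finset.mem_Ico]
  omega

lemma expect_mul_runInd_sub {k j : ℕ} (hj : j ∈ Finset.Icc 1 m) {H : Equiv.Perm (Fin m) → ℝ}
    (hH : SwapInvariant (Finset.Ico j (j + (k + 2))) H) :
    𝔼 σ, H σ * (runInd k j σ - runInd (k + 1) j σ) =
      (runProb m k j - runProb m (k + 1) j) * 𝔼 σ, H σ := by
  rw [Finset.mem_Icc] at hj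
  rw [← Icc_eq_Ico_window] at hH
  simp_rw [mul_sub]
  rw [Finset.expect_sub_distrib, expect_mul_runInd hj.1 hj.2 hH, expect_mul_runInd hj.1 hj.2
    (hH.mono (Finset.Icc_subset_Icc_right (by omega))), sub_mul]

lemma expect_exp_runInd_le (k : ℕ) (u : ℝ) :
    𝔼 σ : Equiv.Perm (Fin m), Real.exp (u * (∑ j ∈ Finset.Icc 1 m, runInd k j σ -
      ∑ j ∈ Finset.Icc 1 m, runProb m k j)) ≤
      Real.exp ((∑ j ∈ Finset.Icc 1 m, runProb m k j) / (k + 1 : ℕ) *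
        (Real.exp ((k + 1 : ℕ) * u) - 1 - (k + 1 : ℕ) * u)) := by
  refine expect_exp_sum_le (runInd k) (runProb m k) _ (Nat.succ_pos k) u (runInd_eq_zero_or_one k)
    (runProb_nonneg m k) (runProb_le_one m k) fun r a ↦ ?_
  refine expect_prod_eq (w := k + 1) _ _ a (fun j ↦ ?_) (fun j hj H hH ↦ ?_) _
    (Finset.filter_subset _ _) r (fun j hj ↦ (Finset.mem_filter.1 hj).2)
  · rw [← Icc_eq_Ico_window]
    exact labelsDetermine_runInd k j
  · rw [← Icc_eq_Ico_window] at hH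
    rw [Finset.mem_Icc] at hj
    exact expect_mul_runInd hj.1 hj.2 hH

lemma expect_exp_runInd_sub_le (k : ℕ) (u : ℝ) :
    𝔼 σ : Equiv.Perm (Fin m), Real.exp (u *
      (∑ j ∈ Finset.Icc 1 m, (runInd k j σ - runInd (k + 1) j σ) -
        ∑ j ∈ Finset.Icc 1 m, (runProb m k j - runProb m (k + 1) j))) ≤
      Real.exp ((∑ j ∈ Finset.Icc 1 m, (runProb m k j - runProb m (k + 1) j)) / (k + 2 : ℕ) *
        (Real.exp ((k + 2 : ℕ) * u) - 1 - (k + 2 : ℕ) * u)) := by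
  refine expect_exp_sum_le (fun j σ ↦ runInd k j σ - runInd (k + 1) j σ)
    (fun j ↦ runProb m k j - runProb m (k + 1) j) _ (by omega) u (runInd_sub_eq_zero_or_one k)
    (fun j ↦ sub_nonneg.2 (runProb_succ_le m k j))
    (fun j ↦ by linarith [runProb_le_one m k j, runProb_nonneg m (k + 1) j]) fun r a ↦ ?_
  refine expect_prod_eq (w := k + 2) (fun j σ ↦ runInd k j σ - runInd (k + 1) j σ)
    (fun j ↦ runProb m k j - runProb m (k + 1) j) a (fun j ↦ ?_)
    (fun j hj H hH ↦ expect_mul_runInd_sub hj hH) _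
    (Finset.filter_subset _ _) r (fun j hj ↦ (Finset.mem_filter.1 hj).2)
  intro σ τ h
  rw [← Icc_eq_Ico_window] at h
  show _ - _ = _ - _
  rw [labelsDetermine_runInd (k + 1) j σ τ h, (labelsDetermine_runInd k j).mono
    (Finset.Icc_subset_Icc_right (by omega)) σ τ h]

end Runs

/-! ### Tails of L and M from the run counts -/

section Tails

open scoped BigOperators

variable {m : ℕ}

lemma meanL_eq {k : ℕ} (hk : k + 1 ≤ m) :
    meanL k (m + 1) = ((m : ℝ) + 1) / ((k + 1) * (k + 2)) := by
  rw [meanL, integral_uniformLaw, expect_history_eq, ← sum_runProb_sub hk]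
  simp_rw [L_treeOf_eq hk]
  rw [Finset.expect_sum_comm]
  refine Finset.sum_congr rfl fun j hj ↦ ?_
  have h := expect_mul_runInd_sub (k := k) hj (H := fun _ ↦ 1) (fun _ _ _ _ _ ↦ rfl)
  simpa using h

lemma L_upper_tail {k : ℕ} (hk : k + 1 ≤ m) {t : ℝ} (ht : 0 < t) :
    (uniformLaw (m + 1)).real {p | meanL k (m + 1) + t ≤ (L k (m + 1) p : ℝ)} ≤
      Real.exp (-(t ^ 2 / (2 * ((k : ℝ) + 2) * (meanL k (m + 1) + t / 3)))) := by
  have hpos : 0 < meanL k (m + 1) := by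
    rw [meanL_eq hk]
    positivity
  have hE := fun u ↦ expect_exp_runInd_sub_le (m := m) k u
  rw [sum_runProb_sub hk, ← meanL_eq hk] at hE
  push_cast at hE
  rw [uniformLaw_real_setOf, expect_history_eq]
  simp_rw [L_treeOf_eq hk]
  exact expect_upper_tail_le _ hpos ht (by positivity) hE

lemma L_lower_tail {k : ℕ} (hk : k + 1 ≤ m) {t : ℝ} (ht : 0 < t) :
    (uniformLaw (m + 1)).real {p | (L k (m + 1) p : ℝ) ≤ meanL k (m + 1) - t} ≤
      Real.exp (-(t ^ 2 / (2 * ((k : ℝ) + 2) * meanL k (m + 1)))) := by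
  have hpos : 0 < meanL k (m + 1) := by
    rw [meanL_eq hk]
    positivity
  have hE := fun u ↦ expect_exp_runInd_sub_le (m := m) k u
  rw [sum_runProb_sub hk, ← meanL_eq hk] at hE
  push_cast at hE
  rw [uniformLaw_real_setOf, expect_history_eq]
  simp_rw [L_treeOf_eq hk]
  exact expect_lower_tail_le _ hpos.le le_rfl hpos ht (by positivity) hE

lemma M_lower_tail {k : ℕ} (hk : k ≤ m) {t : ℝ} (ht : 0 < t) :
    (uniformLaw (m + 1)).real {p | (M k (m + 1) p : ℝ) ≤ ((m : ℝ) + 1) / (k + 1) - t} ≤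
      Real.exp (-(t ^ 2 / (2 * ((m : ℝ) + 1)))) := by
  have hE := fun u ↦ expect_exp_runInd_le (m := m) k u
  rw [sum_runProb hk] at hE
  push_cast at hE
  have hkm : (k : ℝ) ≤ m := by exact_mod_cast hk
  -- Enlarging the mean (m - k)/(k + 1) to this S makes 2(k + 1)S = 2(m + 1), free of k. The shift
  -- by 1 between the two is the root's contribution.
  have h := expect_lower_tail_le (S := ((m : ℝ) + 1) / (k + 1)) _
    (div_nonneg (by linarith) (by positivity)) (by gcongr; linarith [k.cast_nonneg (α := ℝ)])
    (by positivity) ht (by positivity) hE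
  have h2 : 2 * ((k : ℝ) + 1) * (((m : ℝ) + 1) / (k + 1)) = 2 * ((m : ℝ) + 1) := by
    field_simp
  rw [h2] at h
  rw [uniformLaw_real_setOf, expect_history_eq]
  refine le_of_eq_of_le (Finset.expect_congr rfl fun σ _ ↦ ?_) h
  rw [M_treeOf_eq hk]
  have h3 : ((m : ℝ) + 1) / (k + 1) = ((m : ℝ) - k) / (k + 1) + 1 := by
    field_simp
    ring
  rw [h3]
  congr 1
  rw [eq_iff_iff]
  constructor <;> intro h <;> linarith

end Tails

/-! ### Comparison of constants -/

section Bounds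

lemma L_upper_bound {k m : ℕ} (hk : k + 1 ≤ m) {t : ℝ} (ht : 0 < t) :
    (uniformLaw (m + 1)).real {p | meanL k (m + 1) + t ≤ (L k (m + 1) p : ℝ)} ≤
      Real.exp (-(8 * t ^ 2 * ((k : ℝ) + 2)) /
        (25 * (((m : ℝ) + 1) + ((k : ℝ) + 1) * ((k : ℝ) + 2) * t / 3))) := by
  rcases Nat.eq_zero_or_pos k with rfl | hk0
  · have h : {p : History (m + 1) | meanL 0 (m + 1) + t ≤ (L 0 (m + 1) p : ℝ)} =
        {p | (M 1 (m + 1) p : ℝ) ≤ ((m : ℝ) + 1) / 2 - t} := by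
      ext p
      simp only [Set.mem_ofPred_eq, meanL_eq hk, L_zero_eq]
      norm_num
      constructor <;> intro h <;> linarith
    rw [h]
    refine (M_one_lower_tail (by omega) ht).trans (Real.exp_le_exp.2 ?_)
    rw [neg_div, neg_le_neg_iff, div_le_div_iff₀ (by positivity) (by positivity)]
    push_cast
    have h1 : 0 < t ^ 2 * ((m : ℝ) + 1) := by positivity
    have h2 : 0 < t ^ 2 * t := by positivity
    nlinarith
  · refine (L_upper_tail hk ht).trans (Real.exp_le_exp.2 ?_)
    set Q := meanL k (m + 1) with hQ
    have hQeq : ((m : ℝ) + 1) = Q * ((k + 1) * (k + 2)) := by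
      rw [hQ, meanL_eq hk]
      field_simp
    have hQ0 : 0 < Q := by
      rw [hQ, meanL_eq hk]
      positivity
    have hk1 : (1 : ℝ) ≤ k := by exact_mod_cast hk0
    rw [hQeq, neg_div, neg_le_neg_iff]
    have h1 : 8 * t ^ 2 * ((k : ℝ) + 2) / (25 * (Q * ((k + 1) * (k + 2)) +
        ((k : ℝ) + 1) * ((k : ℝ) + 2) * t / 3)) = 8 * t ^ 2 / (25 * (k + 1) * (Q + t / 3)) := by
      field_simp
    have h2 : t ^ 2 / (2 * ((k : ℝ) + 2) * (Q + t / 3)) =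
        8 * t ^ 2 / (16 * (k + 2) * (Q + t / 3)) := by
      field_simp
      norm_num
    rw [h1, h2]
    -- Everything reduces to 16(k + 2) ≤ 25(k + 1), true for k ≥ 1 but not for k = 0.
    refine div_le_div_of_nonneg_left (by positivity) (by positivity)
      (mul_le_mul_of_nonneg_right (by linarith) (by positivity))

lemma L_lower_bound {k m : ℕ} (hk : k + 1 ≤ m) {t : ℝ} (ht : 0 < t) :
    (uniformLaw (m + 1)).real {p | (L k (m + 1) p : ℝ) ≤ meanL k (m + 1) - t} ≤
      Real.exp (-(8 * t ^ 2 * ((k : ℝ) + 2)) / (25 * ((m : ℝ) + 1))) := by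
  rcases Nat.eq_zero_or_pos k with rfl | hk0
  · have h : {p : History (m + 1) | (L 0 (m + 1) p : ℝ) ≤ meanL 0 (m + 1) - t} =
        {p | ((m : ℝ) + 1) / 2 + t ≤ (M 1 (m + 1) p : ℝ)} := by
      ext p
      simp only [Set.mem_ofPred_eq, meanL_eq hk, L_zero_eq]
      norm_num
      constructor <;> intro h <;> linarith
    rw [h]
    refine (M_one_upper_tail (by omega) ht).trans (Real.exp_le_exp.2 ?_)
    rw [neg_div, neg_le_neg_iff, div_le_div_iff₀ (by positivity) (by positivity)]
    push_cast
    have h1 : 0 < t ^ 2 * ((m : ℝ) + 1) := by positivity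
    nlinarith
  · refine (L_lower_tail hk ht).trans (Real.exp_le_exp.2 ?_)
    set Q := meanL k (m + 1) with hQ
    have hQeq : ((m : ℝ) + 1) = Q * ((k + 1) * (k + 2)) := by
      rw [hQ, meanL_eq hk]
      field_simp
    have hQ0 : 0 < Q := by
      rw [hQ, meanL_eq hk]
      positivity
    have hk1 : (1 : ℝ) ≤ k := by exact_mod_cast hk0
    rw [hQeq, neg_div, neg_le_neg_iff]
    have h1 : 8 * t ^ 2 * ((k : ℝ) + 2) / (25 * (Q * ((k + 1) * (k + 2)))) =
        8 * t ^ 2 / (25 * (k + 1) * Q) := by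
      field_simp
    have h2 : t ^ 2 / (2 * ((k : ℝ) + 2) * Q) = 8 * t ^ 2 / (16 * (k + 2) * Q) := by
      field_simp
      norm_num
    rw [h1, h2]
    refine div_le_div_of_nonneg_left (by positivity) (by positivity)
      (mul_le_mul_of_nonneg_right (by linarith) (by positivity))

lemma M_lower_bound {k m : ℕ} (hk : 1 ≤ k) (hm : 1 ≤ m) :
    (uniformLaw (m + 1)).real {p | (M k (m + 1) p : ℝ) ≤ ((m : ℝ) + 1) / (3 * (k : ℝ))} ≤
      (k : ℝ) * Real.exp (-(1 / 32) * (((m : ℝ) + 1) / (k : ℝ) ^ 2)) := by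
  have hm1 : (1 : ℝ) ≤ m := by exact_mod_cast hm
  rcases Nat.lt_or_ge m k with hkm | hkm
  -- For k ≥ n the bound is trivial: the exponential is at least 1/2 and k ≥ 2. Only here is the
  -- factor k needed.
  · refine measureReal_le_one.trans ?_
    have hk2 : (2 : ℝ) ≤ k := by exact_mod_cast (by omega : 2 ≤ k)
    have hkm' : (m : ℝ) + 1 ≤ k := by exact_mod_cast hkm
    have h1 : ((m : ℝ) + 1) / (k : ℝ) ^ 2 ≤ 1 := by
      rw [div_le_one (by positivity)]
      nlinarith
    have h2 := Real.add_one_le_exp (-(1 / 32) * (((m : ℝ) + 1) / (k : ℝ) ^ 2))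
    have h3 : (1 / 2 : ℝ) ≤ Real.exp (-(1 / 32) * (((m : ℝ) + 1) / (k : ℝ) ^ 2)) := by linarith
    nlinarith
  have hk1 : (1 : ℝ) ≤ k := by exact_mod_cast hk
  suffices h : (uniformLaw (m + 1)).real
      {p | (M k (m + 1) p : ℝ) ≤ ((m : ℝ) + 1) / (3 * (k : ℝ))} ≤
      Real.exp (-(1 / 32) * (((m : ℝ) + 1) / (k : ℝ) ^ 2)) from
    h.trans (le_mul_of_one_le_left (Real.exp_pos _).le hk1)
  rcases hk.eq_or_lt with rfl | hk2
  -- For k = 1 the window argument would give only n/72 in the exponent; the martingale gives n/9.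
  · have h := M_one_lower_tail hm (t := ((m : ℝ) + 1) / 6) (by positivity)
    have h1 : ((m : ℝ) + 1) / 2 - ((m : ℝ) + 1) / 6 = ((m : ℝ) + 1) / (3 * ((1 : ℕ) : ℝ)) := by
      push_cast
      ring
    rw [h1] at h
    refine h.trans (Real.exp_le_exp.2 ?_)
    have h2 : 4 * (((m : ℝ) + 1) / 6) ^ 2 / ((m : ℝ) + 1) = ((m : ℝ) + 1) / 9 := by
      field_simp
      norm_num
    rw [h2]
    push_cast
    linarith
  · have hk2' : (2 : ℝ) ≤ k := by exact_mod_cast hk2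
    set N : ℝ := (m : ℝ) + 1 with hN
    have hN0 : 0 < N := by positivity
    -- Solves N/(k + 1) - (N/k)s = N/(3k); the constant 1/32 is s²/2 at the lower bound s = 1/4.
    set s : ℝ := (2 * k - 1) / (3 * (k + 1)) with hs
    have hs0 : 1 / 4 ≤ s := by
      rw [hs, div_le_div_iff₀ (by norm_num) (by positivity)]
      linarith
    have ht0 : 0 < N / k * s := by positivity
    have h := M_lower_tail hkm ht0
    have h1 : N / ((k : ℝ) + 1) - N / k * s = N / (3 * k) := by
      rw [hs]
      field_simp
      ring
    rw [← hN, h1] at h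
    refine h.trans (Real.exp_le_exp.2 ?_)
    have h2 : (N / k * s) ^ 2 / (2 * N) = s ^ 2 / 2 * (N / (k : ℝ) ^ 2) := by
      field_simp
    rw [h2, neg_mul, neg_le_neg_iff]
    exact mul_le_mul_of_nonneg_right (by nlinarith) (by positivity)

end Bounds

end RecursiveTree

theorem mainTheorem7 :
    (∀ k n : ℕ, k + 1 < n →
      RecursiveTree.meanL k n = (n : ℝ) / (((k : ℝ) + 1) * ((k : ℝ) + 2)) ∧
      ∀ t : ℝ, 0 < t →
        (RecursiveTree.uniformLaw n).real
            {p | RecursiveTree.meanL k n + t ≤ (RecursiveTree.L k n p : ℝ)} ≤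
          Real.exp (-(8 * t ^ 2 * ((k : ℝ) + 2)) /
            (25 * ((n : ℝ) + ((k : ℝ) + 1) * ((k : ℝ) + 2) * t / 3))) ∧
        (RecursiveTree.uniformLaw n).real
            {p | (RecursiveTree.L k n p : ℝ) ≤ RecursiveTree.meanL k n - t} ≤
          Real.exp (-(8 * t ^ 2 * ((k : ℝ) + 2)) / (25 * (n : ℝ)))) ∧
    (∀ k n : ℕ, 1 ≤ k → 2 ≤ n →
      (RecursiveTree.uniformLaw n).real
          {p | (RecursiveTree.M k n p : ℝ) ≤ (n : ℝ) / (3 * (k : ℝ))} ≤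
        (k : ℝ) * Real.exp (-(1 / 32) * ((n : ℝ) / (k : ℝ) ^ 2))) := by
  constructor
  · intro k n hn
    obtain ⟨m, rfl⟩ : ∃ m, n = m + 1 := ⟨n - 1, by omega⟩
    have hk : k + 1 ≤ m := by omega
    rw [Nat.cast_add_one]
    exact ⟨RecursiveTree.meanL_eq hk, fun t ht ↦
      ⟨RecursiveTree.L_upper_bound hk ht, RecursiveTree.L_lower_bound hk ht⟩⟩
  · intro k n hk hn
    obtain ⟨m, rfl⟩ : ∃ m, n = m + 1 := ⟨n - 1, by omega⟩
    rw [Nat.cast_add_one]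
    exact RecursiveTree.M_lower_bound hk (by omega)
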